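/- For $0<\theta\le 1$ and an integer $N\ge 1$, the single-well random walk between $-N$ and $N$ with parameter $\theta$ is a Markov chain $(X^{(N)}_n)_{n\ge 0}$ with integer values, started at $X^{(N)}_0=0$, whose transition probabilities satisfy $$Q(x,x+1)=\theta,\quad Q(x,x-1)=1-\theta\qquad(1\le x\le N-1),$$ $$Q(x,x+1)=1-\theta,\quad Q(x,x-1)=\theta\qquad(-N+1\le x\le 0);$$ the transition probabilities from all other points (in particular from $\pm N$) are arbitrary, as they do not influence the walk before it hits $\{-N,N\}$. Let $\tau_N=\inf\{n\ge 0: X^{(N)}_n\in\{-N,N\}\}$, and write $P_\theta$, $E_\theta$ for probability and expectation. **Theorem.** For every $\theta\in(0,1/2)\cup(1/2,1]$ and every $N\ge1$ one has $0<E_\theta[\tau_N]<\infty$. Moreover: (i) If $0<\theta<1/2$, then $\tau_N/E_\theta[\tau_N]$ converges in distribution, as $N\to\infty$, to an exponential random variable with parameter $1$. In particular the state $\theta$ is metastable, i.e. $$P_\theta\big(\tau_N/E_\theta[\tau_N]>t\big)\longrightarrow e^{-t}\quad\text{as } N\to\infty,\text{ for every } t\ge 0.$$ (ii) If $1/2<\theta\le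 1$, and the walks $X^{(N)}$, $N\ge 1$, are defined on a common probability space (with an arbitrary joint law), then $$\frac{\tau_N}{E_\theta[\tau_N]}\longrightarrow 1\quad\text{almost surely, as } N\to\infty.$$ In particular the state $\theta$ shows cut-off, i.e. there are constants $c_1,c_2>0$, independent of $N$, with $$P_\theta\big(c_1<\tau_N/E_\theta[\tau_N]<c_2\big)\longrightarrow 1\quad\text{as } N\to\infty.$$ -/

import Mathlib

open MeasureTheory ProbabilityTheory Filter Topology
open scoped ENNReal

namespace SingleWell

/-- `Q` is a stochastic matrix on `S`: nonnegative entries and rows of total mass one. -/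
structure IsStochastic {S : Type*} (Q : S → S → ℝ) : Prop where
  nonneg : ∀ x y, 0 ≤ Q x y
  row_sum : ∀ x, HasSum (Q x) 1

/-- Under `P`, the process `X` is a (time-homogeneous, discrete-time) Markov chain with
transition matrix `Q`, started at `x₀`. The Markov property is stated on cylinders:
`P(X₀ = s₀, …, Xₙ₊₁ = sₙ₊₁) = P(X₀ = s₀, …, Xₙ = sₙ) Q(sₙ, sₙ₊₁)`. -/
structure IsMarkovChain {S : Type*} [MeasurableSpace S] {Ω : Type*} [MeasurableSpace Ω]
    (P : Measure Ω) (Q : S → S → ℝ) (x₀ : S) (X : ℕ → Ω → S) : Prop where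
  measurable : ∀ n, Measurable (X n)
  start : ∀ᵐ ω ∂P, X 0 ω = x₀
  step : ∀ (n : ℕ) (s : ℕ → S),
    P.real {ω | ∀ k ≤ n + 1, X k ω = s k} = P.real {ω | ∀ k ≤ n, X k ω = s k} * Q (s n) (s (n + 1))

/-- The single-well transition probabilities in the state `θ`: from `x ≥ 1` the walk goes right
with probability `θ` and left with probability `1 - θ`; from `x ≤ 0` it goes left with
probability `θ` and right with probability `1 - θ`. -/
noncomputable def transition (θ : ℝ) (x y : ℤ) : ℝ :=
  if 1 ≤ x then
    if y = x + 1 then θ else if y = x - 1 then 1 - θ else 0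
  else
    if y = x + 1 then 1 - θ else if y = x - 1 then θ else 0

/-- `X` is a single-well random walk between `-N` and `N` in the state `θ`, started at `0`: a Markov
chain from `0` whose transition matrix has the single-well rows at every `x ∈ [-N + 1, N - 1]`.
The rows at `-N` and `N` are arbitrary, since they do not influence the walk before it hits
`{-N, N}`. The chain is regarded as taking values in `ℤ`, and the rows outside `[-N, N]` are
arbitrary for the same reason. So this comprises the chains that live on `[-N, N]` and
are, for instance, absorbed at `-N` and `N` or restarted at `0` from there, and also
the walk on all of `ℤ` with the single-well rows everywhere. -/
def IsWalk {Ω : Type*} [MeasurableSpace Ω] (P : Measure Ω) (θ : ℝ) (N : ℕ)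
    (X : ℕ → Ω → ℤ) : Prop :=
  ∃ Q : ℤ → ℤ → ℝ, IsStochastic Q ∧
    (∀ x : ℤ, -(N : ℤ) < x → x < N → ∀ y, Q x y = transition θ x y) ∧
    IsMarkovChain P Q 0 X

/-- `τ_N`: the first time the process `X` hits the target set `{-N, N}` (`⊤` if it never does). -/
noncomputable def hitTime {Ω : Type*} (N : ℕ) (X : ℕ → Ω → ℤ) (ω : Ω) : ℕ∞ :=
  hittingAfter X {-(N : ℤ), (N : ℤ)} 0 ω

/-- `E[τ]`, with values in `[0, ∞]`. -/
noncomputable def mean {Ω : Type*} [MeasurableSpace Ω] (P : Measure Ω) (τ : Ω → ℕ∞) : ℝ≥0∞ :=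
  ∫⁻ ω, (τ ω : ℝ≥0∞) ∂P

/-- `τ / E[τ]`, as a real random variable. It is meaningful when `0 < E[τ] < ∞`, and then `τ` is
almost surely finite. -/
noncomputable def normalized {Ω : Type*} [MeasurableSpace Ω] (P : Measure Ω) (τ : Ω → ℕ∞)
    (ω : Ω) : ℝ :=
  ((τ ω : ℝ≥0∞) / mean P τ).toReal

/-- Metastability: `P_N(τ_N / E[τ_N] > t) → exp(-t)` as `N → ∞`, for all `t ≥ 0`. -/
def Metastable {Ω : ℕ+ → Type*} [∀ N, MeasurableSpace (Ω N)] (P : ∀ N, Measure (Ω N))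
    (τ : ∀ N, Ω N → ℕ∞) : Prop :=
  ∀ t : ℝ, 0 ≤ t →
    Tendsto (fun N => (P N).real {ω | t < normalized (P N) (τ N) ω}) atTop (𝓝 (Real.exp (-t)))

/-- Cut-off: there are constants `c₁, c₂ > 0` such that `P_N(c₁ < τ_N / E[τ_N] < c₂) → 1`
as `N → ∞`. -/
def CutOff {Ω : ℕ+ → Type*} [∀ N, MeasurableSpace (Ω N)] (P : ∀ N, Measure (Ω N))
    (τ : ∀ N, Ω N → ℕ∞) : Prop :=
  ∃ c₁ c₂ : ℝ, 0 < c₁ ∧ 0 < c₂ ∧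
    Tendsto (fun N => (P N).real {ω | c₁ < normalized (P N) (τ N) ω ∧
      normalized (P N) (τ N) ω < c₂}) atTop (𝓝 1)

instance isProbabilityMeasure_exp_one : IsProbabilityMeasure (expMeasure 1) :=
  isProbabilityMeasure_expMeasure one_pos

end SingleWell

/-!
Killed on reaching `N`, the distance `|X|` of the walk from `0` is a birth-and-death chain: from `0`
it moves to `1`, and from `k ≥ 1` it moves to `k + 1` with probability `θ` and to `k - 1` with
probability `1 - θ`. Let `h` be the solution of `h 0 = 0` for which `h |Xₙ| - n` is a martingale
before the killing; optional stopping gives `E[τ_N] = h N`, and more precisely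
`P(n < τ_N) = 1 - (∑_{k < n} P(k < τ_N)) / h N + E[h |Xₙ|; n < τ_N] / h N`.

If `θ < 1/2`, choose `1 < a < (1 - θ) / θ`. The moments `E[a ^ |Xₙ|; n < τ_N]` are bounded in `n`
and `N`, whereas `h N / h k ≥ a ^ (N - k)`. The last term of the identity is therefore `O(a ^ (-N))`
uniformly in `n`, so that `P(n < τ_N)` is uniformly close to the geometric tail
`(1 - 1 / h N) ^ n`, which on the time scale `h N` is exponential.

If `θ > 1/2`, then `h N ~ N / (2θ - 1)`, and exponential supermartingales built from `a ^ |Xₙ|` with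
`a` slightly smaller or larger than `1` show that `P(τ_N > t h N)` for `t > 1` and
`P(τ_N ≤ t h N)` for `t < 1` decay exponentially in `N`. By Borel-Cantelli `τ_N / h N → 1` almost
surely, whatever the joint law of the walks.
-/

namespace SingleWell

section MarkovChain

variable {S Ω : Type*} [MeasurableSpace Ω]

lemma measureReal_and_mem_finset [MeasurableSpace S] [MeasurableSingletonClass S]
    (P : Measure Ω) [IsFiniteMeasure P] {Y : Ω → S} (hY : Measurable Y) (p : Ω → Prop)
    (B : Finset S) :
    P.real {ω | p ω ∧ Y ω ∈ B} = ∑ x ∈ B, P.real {ω | p ω ∧ Y ω = x} := by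
  have h := sum_measureReal_preimage_singleton (μ := P.restrict {ω | p ω}) B
    fun x _ => hY (measurableSet_singleton x)
  simp only [measureReal_restrict_apply (hY (measurableSet_singleton _)),
    measureReal_restrict_apply (hY B.measurableSet), Set.inter_comm _ {ω | p ω}] at h
  exact h.symm

/-- The law at time `n` of the chain with transition matrix `Q` started at `x₀` and killed by its
first step out of a point outside `B`: `killedLaw Q x₀ B n x` is the probability of being in `B` at
all times before `n` and at `x` at time `n`. -/
noncomputable def killedLaw [DecidableEq S] (Q : S → S → ℝ) (x₀ : S) (B : Finset S) : ℕ → S → ℝ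
  | 0, x => if x = x₀ then 1 else 0
  | n + 1, y => ∑ x ∈ B, killedLaw Q x₀ B n x * Q x y

lemma killedLaw_congr [DecidableEq S] {Q Q' : S → S → ℝ} {B : Finset S}
    (h : ∀ x ∈ B, ∀ y, Q x y = Q' x y) (x₀ : S) : killedLaw Q x₀ B = killedLaw Q' x₀ B := by
  funext n
  induction n with
  | zero => rfl
  | succ n ih => exact funext fun y => Finset.sum_congr rfl fun x hx => by rw [ih, h x hx y]

lemma killedLaw_nonneg [DecidableEq S] {Q : S → S → ℝ} (hQ : ∀ x y, 0 ≤ Q x y) (x₀ : S)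
    (B : Finset S) (n : ℕ) (y : S) : 0 ≤ killedLaw Q x₀ B n y := by
  induction n generalizing y with
  | zero => unfold killedLaw; positivity
  | succ n ih => exact Finset.sum_nonneg fun x _ => mul_nonneg (ih x) (hQ x y)

namespace IsMarkovChain

variable [MeasurableSpace S] [MeasurableSingletonClass S] {P : Measure Ω} [IsProbabilityMeasure P]
  {Q : S → S → ℝ} {x₀ : S} {X : ℕ → Ω → S}

lemma measureReal_cylinder_succ (hX : IsMarkovChain P Q x₀ X) (B : Finset S) {j n : ℕ}
    (hj : j ≤ n) (s : ℕ → S) :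
    P.real {ω | (∀ k < j, X k ω ∈ B) ∧ ∀ k ≤ n + 1, j ≤ k → X k ω = s k} =
      P.real {ω | (∀ k < j, X k ω ∈ B) ∧ ∀ k ≤ n, j ≤ k → X k ω = s k} * Q (s n) (s (n + 1)) := by
  classical
  induction j generalizing s with
  | zero => simpa using hX.step n s
  | succ j ih =>
    have free_coordinate (m : ℕ) (hm : j < m) :
        P.real {ω | (∀ k < j + 1, X k ω ∈ B) ∧ ∀ k ≤ m, j + 1 ≤ k → X k ω = s k} =
          ∑ x ∈ B, P.real {ω | (∀ k < j, X k ω ∈ B) ∧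
            ∀ k ≤ m, j ≤ k → X k ω = Function.update s j x k} := by
      calc _ = P.real {ω | ((∀ k < j, X k ω ∈ B) ∧ ∀ k ≤ m, j + 1 ≤ k → X k ω = s k) ∧
            X j ω ∈ B} := by
            congr 1; ext ω
            grind
        _ = _ := measureReal_and_mem_finset P (hX.measurable j) _ B
        _ = _ := Finset.sum_congr rfl fun x _ => by
            congr 1; ext ω
            grind [Function.update_apply]
    rw [free_coordinate _ (by omega), free_coordinate _ (by omega), Finset.sum_mul]
    refine Finset.sum_congr rfl fun x _ => ?_
    rw [ih (by omega), Function.update_of_ne (by omega), Function.update_of_ne (by omega)]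

lemma measureReal_forall_mem_and_eq_and_eq (hX : IsMarkovChain P Q x₀ X) (B : Finset S) (n : ℕ)
    (x y : S) :
    P.real {ω | ((∀ k < n, X k ω ∈ B) ∧ X (n + 1) ω = y) ∧ X n ω = x} =
      P.real {ω | (∀ k < n, X k ω ∈ B) ∧ X n ω = x} * Q x y := by
  have h := hX.measureReal_cylinder_succ B (le_refl n) fun k => if k = n then x else y
  simp only [if_true, n.succ_ne_self, if_false] at h
  convert h using 2
  · congr 1; ext ω; grind
  · congr 1; ext ω; grind

theorem measureReal_forall_mem_and_eq [DecidableEq S] (hX : IsMarkovChain P Q x₀ X)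
    (B : Finset S) (n : ℕ) (y : S) :
    P.real {ω | (∀ k < n, X k ω ∈ B) ∧ X n ω = y} = killedLaw Q x₀ B n y := by
  induction n generalizing y with
  | zero =>
    have hstart : {ω | (∀ k < 0, X k ω ∈ B) ∧ X 0 ω = y} =ᵐ[P] {_ω | y = x₀} := by
      filter_upwards [hX.start] with ω hω
      exact propext (show ((∀ k < 0, X k ω ∈ B) ∧ X 0 ω = y) ↔ y = x₀ by simp [hω, eq_comm])
    rw [measureReal_congr hstart, killedLaw]
    split_ifs with h <;> simp [h]
  | succ n ih =>
    calc P.real {ω | (∀ k < n + 1, X k ω ∈ B) ∧ X (n + 1) ω = y}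
        = P.real {ω | ((∀ k < n, X k ω ∈ B) ∧ X (n + 1) ω = y) ∧ X n ω ∈ B} := by
          congr 1; ext ω
          grind
      _ = ∑ x ∈ B, P.real {ω | ((∀ k < n, X k ω ∈ B) ∧ X (n + 1) ω = y) ∧ X n ω = x} :=
          measureReal_and_mem_finset P (hX.measurable n) _ B
      _ = killedLaw Q x₀ B (n + 1) y := Finset.sum_congr rfl fun x _ => by
          rw [hX.measureReal_forall_mem_and_eq_and_eq, ih]

theorem measureReal_forall_mem [DecidableEq S] (hX : IsMarkovChain P Q x₀ X) (B : Finset S)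
    (n : ℕ) : P.real {ω | ∀ k ≤ n, X k ω ∈ B} = ∑ x ∈ B, killedLaw Q x₀ B n x := by
  simp only [← hX.measureReal_forall_mem_and_eq,
    ← measureReal_and_mem_finset P (hX.measurable n)]
  congr 1; ext ω
  grind

end IsMarkovChain

end MarkovChain

section KilledWalk

variable {θ : ℝ} {N : ℕ}

lemma transition_nonneg (h0 : 0 ≤ θ) (h1 : θ ≤ 1) (x y : ℤ) : 0 ≤ transition θ x y := by
  unfold transition
  split_ifs <;> linarith

lemma transition_eq_add (x y : ℤ) : transition θ x y =
    (if y = x + 1 then (if 1 ≤ x then θ else 1 - θ) else 0) +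
      (if y = x - 1 then (if 1 ≤ x then 1 - θ else θ) else 0) := by
  have : y = x + 1 → ¬ y = x - 1 := by lia
  unfold transition
  split_ifs <;> simp_all

/-- The interior `{-N + 1, …, N - 1}` of the well, which the walk leaves at time `τ_N`. -/
noncomputable def well (N : ℕ) : Finset ℤ := Finset.Ioo (-(N : ℤ)) N

lemma mem_well {x : ℤ} : x ∈ well N ↔ x.natAbs < N := by
  rw [well, Finset.mem_Ioo]
  lia

/-- The transition operator of the distance `|X|` of the single-well walk from `0`. -/
def radialStep (θ : ℝ) (g : ℕ → ℝ) : ℕ → ℝ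
  | 0 => g 1
  | k + 1 => θ * g (k + 2) + (1 - θ) * g k

lemma radialStep_one : radialStep θ 1 = 1 := by
  funext k
  cases k <;> simp [radialStep]

lemma sum_transition_mul (g : ℕ → ℝ) {x : ℤ} (hx : x ∈ well N) :
    ∑ y ∈ Finset.Icc (-(N : ℤ)) N, transition θ x y * g y.natAbs = radialStep θ g x.natAbs := by
  rw [mem_well] at hx
  simp only [transition_eq_add, add_mul, ite_zero_mul, Finset.sum_add_distrib,
    Finset.sum_ite_eq', Finset.mem_Icc]
  rw [if_pos (show -(N : ℤ) ≤ x + 1 ∧ x + 1 ≤ N by lia),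
    if_pos (show -(N : ℤ) ≤ x - 1 ∧ x - 1 ≤ N by lia)]
  rcases h : x.natAbs with _ | k
  · obtain rfl : x = 0 := by lia
    norm_num [radialStep]
    ring
  · rcases le_or_gt 1 x with hpos | hneg
    · rw [if_pos hpos, if_pos hpos, show (x + 1).natAbs = k + 2 by lia,
        show (x - 1).natAbs = k by lia, radialStep]
    · rw [if_neg (by lia), if_neg (by lia), show (x + 1).natAbs = k by lia,
        show (x - 1).natAbs = k + 2 by lia, radialStep]
      ring

/-- The functional `g ↦ E[g(|Xₙ|); n < τ_N]` of the single-well walk. -/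
noncomputable def aliveMean (θ : ℝ) (N n : ℕ) : (ℕ → ℝ) →ₗ[ℝ] ℝ :=
  ∑ x ∈ well N, killedLaw (transition θ) 0 (well N) n x • LinearMap.proj x.natAbs

/-- The probability `P(n < τ_N)` for the single-well walk. -/
noncomputable def survival (θ : ℝ) (N n : ℕ) : ℝ := aliveMean θ N n 1

lemma aliveMean_apply (n : ℕ) (g : ℕ → ℝ) : aliveMean θ N n g =
    ∑ x ∈ well N, killedLaw (transition θ) 0 (well N) n x * g x.natAbs := by
  simp [aliveMean]

lemma aliveMean_zero (hN : 0 < N) (g : ℕ → ℝ) : aliveMean θ N 0 g = g 0 := by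
  simp [aliveMean_apply, killedLaw, mem_well, hN]

lemma aliveMean_mono (h0 : 0 ≤ θ) (h1 : θ ≤ 1) (n : ℕ) {f g : ℕ → ℝ} (h : ∀ k < N, f k ≤ g k) :
    aliveMean θ N n f ≤ aliveMean θ N n g := by
  simp only [aliveMean_apply]
  exact Finset.sum_le_sum fun x hx => mul_le_mul_of_nonneg_left (h _ (mem_well.1 hx))
    (killedLaw_nonneg (transition_nonneg h0 h1) _ _ _ _)

lemma aliveMean_nonneg (h0 : 0 ≤ θ) (h1 : θ ≤ 1) (n : ℕ) {g : ℕ → ℝ} (h : ∀ k < N, 0 ≤ g k) :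
    0 ≤ aliveMean θ N n g := by
  simpa using aliveMean_mono h0 h1 n (f := 0) h

lemma aliveMean_radialStep_eq_sum (n : ℕ) (g : ℕ → ℝ) :
    aliveMean θ N n (radialStep θ g) = ∑ y ∈ Finset.Icc (-(N : ℤ)) N,
      killedLaw (transition θ) 0 (well N) (n + 1) y * g y.natAbs := by
  simp only [aliveMean_apply, killedLaw, Finset.sum_mul]
  rw [Finset.sum_comm]
  refine Finset.sum_congr rfl fun x hx => ?_
  simp only [← sum_transition_mul g hx, Finset.mul_sum, mul_assoc]

/-- The walk that dies at time `n + 1` is then at distance `N` from `0`. -/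
lemma aliveMean_radialStep (n : ℕ) (g : ℕ → ℝ) :
    aliveMean θ N n (radialStep θ g) = aliveMean θ N (n + 1) g +
      g N * (survival θ N n - survival θ N (n + 1)) := by
  obtain ⟨c, hc⟩ : ∃ c, ∀ g : ℕ → ℝ,
      aliveMean θ N n (radialStep θ g) = aliveMean θ N (n + 1) g + g N * c := by
    refine ⟨∑ y ∈ Finset.Icc (-(N : ℤ)) N \ well N,
      killedLaw (transition θ) 0 (well N) (n + 1) y, fun g => ?_⟩
    rw [aliveMean_radialStep_eq_sum, aliveMean_apply,
      ← Finset.sum_sdiff (Finset.Ioo_subset_Icc_self : well N ⊆ _), add_comm, Finset.mul_sum]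
    congr 1
    refine Finset.sum_congr rfl fun y hy => ?_
    rw [Finset.mem_sdiff, mem_well, Finset.mem_Icc] at hy
    rw [show y.natAbs = N by lia, mul_comm]
  have hone := hc 1
  rw [radialStep_one] at hone
  rw [hc, survival, survival, hone]
  simp

lemma survival_zero (hN : 0 < N) : survival θ N 0 = 1 := aliveMean_zero hN 1

lemma survival_nonneg (h0 : 0 ≤ θ) (h1 : θ ≤ 1) (n : ℕ) : 0 ≤ survival θ N n :=
  aliveMean_nonneg h0 h1 n fun _ _ => zero_le_one

lemma aliveMean_succ_le {V : ℕ → ℝ} {m b : ℝ} (h0 : 0 ≤ θ) (h1 : θ ≤ 1)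
    (hV : ∀ k < N, radialStep θ V k ≤ m * V k + b) (n : ℕ) :
    aliveMean θ N (n + 1) V + V N * (survival θ N n - survival θ N (n + 1)) ≤
      m * aliveMean θ N n V + b * survival θ N n := by
  rw [← aliveMean_radialStep]
  calc aliveMean θ N n (radialStep θ V) ≤ aliveMean θ N n (m • V + b • 1) :=
        aliveMean_mono h0 h1 n fun k hk => by simpa using hV k hk
    _ = m * aliveMean θ N n V + b * survival θ N n := by
        rw [map_add, map_smul, map_smul, smul_eq_mul, smul_eq_mul, survival]

lemma survival_succ_le (h0 : 0 ≤ θ) (h1 : θ ≤ 1) (n : ℕ) :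
    survival θ N (n + 1) ≤ survival θ N n := by
  -- Test against the indicator of `N`, which vanishes where the walk is alive.
  have hstep := aliveMean_radialStep (θ := θ) (N := N) n (Pi.single N 1)
  have halive : aliveMean θ N (n + 1) (Pi.single N 1) = 0 := by
    rw [aliveMean_apply]
    refine Finset.sum_eq_zero fun x hx => ?_
    rw [Pi.single_eq_of_ne (mem_well.1 hx).ne, mul_zero]
  have hnonneg : 0 ≤ aliveMean θ N n (radialStep θ (Pi.single N 1)) := by
    refine aliveMean_nonneg h0 h1 n fun k _ => ?_
    have hsingle (j : ℕ) : (0 : ℝ) ≤ Pi.single (M := fun _ => ℝ) N 1 j := by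
      rw [Pi.single_apply]
      split_ifs <;> simp
    cases k with
    | zero => exact hsingle 1
    | succ k =>
      exact add_nonneg (mul_nonneg h0 (hsingle _)) (mul_nonneg (sub_nonneg.2 h1) (hsingle _))
  rw [halive, Pi.single_eq_same] at hstep
  linarith

lemma survival_le_one (h0 : 0 ≤ θ) (h1 : θ ≤ 1) (hN : 0 < N) (n : ℕ) : survival θ N n ≤ 1 := by
  rw [← survival_zero (θ := θ) hN]
  exact antitone_nat_of_succ_le (survival_succ_le h0 h1) n.zero_le

section Drift

variable {V : ℕ → ℝ} {m : ℝ}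

lemma aliveMean_le_pow_mul (h0 : 0 ≤ θ) (h1 : θ ≤ 1) (hN : 0 < N) (hm : 0 ≤ m) (hVN : 0 ≤ V N)
    (hV : ∀ k < N, radialStep θ V k ≤ m * V k) (n : ℕ) : aliveMean θ N n V ≤ m ^ n * V 0 := by
  induction n with
  | zero => simp [aliveMean_zero hN]
  | succ n ih =>
    have hstep := aliveMean_succ_le (b := 0) h0 h1 (by simpa using hV) n
    have hdead := mul_nonneg hVN (sub_nonneg.2 (survival_succ_le (N := N) h0 h1 n))
    rw [pow_succ', mul_assoc]
    linarith [mul_le_mul_of_nonneg_left ih hm]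

lemma aliveMean_le_add_div (h0 : 0 ≤ θ) (h1 : θ ≤ 1) (hN : 0 < N) {b : ℝ} (hm : 0 ≤ m)
    (hm1 : m < 1) (hb : 0 ≤ b) (hVN : 0 ≤ V N) (hV : ∀ k < N, radialStep θ V k ≤ m * V k + b)
    (hV0 : 0 ≤ V 0) (n : ℕ) : aliveMean θ N n V ≤ V 0 + b / (1 - m) := by
  have hm' : 0 < 1 - m := sub_pos.2 hm1
  induction n with
  | zero =>
    rw [aliveMean_zero hN]
    exact le_add_of_nonneg_right (by positivity)
  | succ n ih =>
    have hstep := aliveMean_succ_le h0 h1 hV n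
    have hdead := mul_nonneg hVN (sub_nonneg.2 (survival_succ_le (N := N) h0 h1 n))
    calc aliveMean θ N (n + 1) V ≤ m * (V 0 + b / (1 - m)) + b * 1 := by
          linarith [mul_le_mul_of_nonneg_left ih hm,
            mul_le_mul_of_nonneg_left (survival_le_one (N := N) h0 h1 hN n) hb]
      _ = m * V 0 + b / (1 - m) := by field_simp; ring
      _ ≤ V 0 + b / (1 - m) := by gcongr; exact mul_le_of_le_one_left hV0 hm1.le

lemma aliveMean_add_mul_one_sub_survival_le (h0 : 0 ≤ θ) (h1 : θ ≤ 1) (hN : 0 < N) (hm : 1 ≤ m)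
    (hVN : 0 ≤ V N) (hV : ∀ k < N, radialStep θ V k ≤ m * V k) (n : ℕ) :
    aliveMean θ N n V + V N * (1 - survival θ N n) ≤ m ^ n * V 0 := by
  induction n with
  | zero => simp [aliveMean_zero hN, survival_zero hN]
  | succ n ih =>
    have hstep := aliveMean_succ_le (b := 0) h0 h1 (by simpa using hV) n
    have hstopped := le_mul_of_one_le_left
      (mul_nonneg hVN (sub_nonneg.2 (survival_le_one h0 h1 hN n))) hm
    rw [pow_succ', mul_assoc]
    linarith [mul_le_mul_of_nonneg_left ih (zero_le_one.trans hm)]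

end Drift

end KilledWalk

section ExpectedTime

variable {θ : ℝ} {N : ℕ}

/-- The expected time in which the distance of the single-well walk from `0` first grows from `k` to
`k + 1`. -/
noncomputable def climb (θ : ℝ) : ℕ → ℝ
  | 0 => 1
  | k + 1 => (1 - θ) / θ * climb θ k + 1 / θ

/-- The expected time in which the distance of the single-well walk from `0` first reaches `N`, see
`IsWalk.mean_eq`. -/
noncomputable def expectedTime (θ : ℝ) (N : ℕ) : ℝ := ∑ k ∈ Finset.range N, climb θ k

lemma ratio_nonneg (h0 : 0 < θ) (h1 : θ ≤ 1) : 0 ≤ (1 - θ) / θ :=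
  div_nonneg (sub_nonneg.2 h1) h0.le

lemma one_le_climb (h0 : 0 < θ) (h1 : θ ≤ 1) (k : ℕ) : 1 ≤ climb θ k := by
  induction k with
  | zero => exact le_rfl
  | succ k ih =>
    have hstep : 1 ≤ 1 / θ := (one_le_div h0).2 h1
    have hback := mul_nonneg (ratio_nonneg h0 h1) (zero_le_one.trans ih)
    rw [climb]
    linarith

lemma expectedTime_zero : expectedTime θ 0 = 0 := by simp [expectedTime]

lemma expectedTime_succ (k : ℕ) : expectedTime θ (k + 1) = expectedTime θ k + climb θ k :=
  Finset.sum_range_succ _ _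

lemma expectedTime_monotone (h0 : 0 < θ) (h1 : θ ≤ 1) : Monotone (expectedTime θ) :=
  monotone_nat_of_le_succ fun k => by
    rw [expectedTime_succ]
    linarith [one_le_climb h0 h1 k]

lemma natCast_le_expectedTime (h0 : 0 < θ) (h1 : θ ≤ 1) (N : ℕ) : N ≤ expectedTime θ N := by
  simpa [expectedTime] using
    Finset.card_nsmul_le_sum (Finset.range N) (climb θ) 1 fun k _ => one_le_climb h0 h1 k

lemma one_le_expectedTime (h0 : 0 < θ) (h1 : θ ≤ 1) (hN : 0 < N) : 1 ≤ expectedTime θ N :=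
  (Nat.one_le_cast.2 hN).trans (natCast_le_expectedTime h0 h1 N)

lemma expectedTime_nonneg (h0 : 0 < θ) (h1 : θ ≤ 1) (N : ℕ) : 0 ≤ expectedTime θ N :=
  N.cast_nonneg.trans (natCast_le_expectedTime h0 h1 N)

lemma tendsto_expectedTime_atTop (h0 : 0 < θ) (h1 : θ ≤ 1) :
    Tendsto (expectedTime θ) atTop atTop :=
  tendsto_atTop_mono (natCast_le_expectedTime h0 h1) tendsto_natCast_atTop_atTop

lemma radialStep_expectedTime (h0 : 0 < θ) :
    radialStep θ (expectedTime θ) = expectedTime θ + 1 := by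
  funext k
  cases k with
  | zero => simp [radialStep, expectedTime, climb]
  | succ k =>
    simp only [radialStep, Pi.add_apply, Pi.one_apply, expectedTime_succ, climb]
    field_simp
    ring

lemma survival_eq_sub (h0 : 0 < θ) (n : ℕ) : survival θ N n =
    (aliveMean θ N (n + 1) (expectedTime θ) - expectedTime θ N * survival θ N (n + 1)) -
      (aliveMean θ N n (expectedTime θ) - expectedTime θ N * survival θ N n) := by
  have hstep := aliveMean_radialStep (θ := θ) (N := N) n (expectedTime θ)
  rw [radialStep_expectedTime h0, map_add, ← survival] at hstep
  linarith

/-- `h(|X|) - n` is a martingale for `h = expectedTime θ`; here it is evaluated at `n ∧ τ_N`. -/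
lemma sum_survival (h0 : 0 < θ) (hN : 0 < N) (n : ℕ) :
    ∑ k ∈ Finset.range n, survival θ N k =
      expectedTime θ N * (1 - survival θ N n) + aliveMean θ N n (expectedTime θ) := by
  rw [Finset.sum_congr rfl fun k _ => survival_eq_sub h0 k, Finset.sum_range_sub
    (fun k => aliveMean θ N k (expectedTime θ) - expectedTime θ N * survival θ N k),
    aliveMean_zero hN, survival_zero hN, expectedTime_zero]
  ring

lemma hasSum_survival (h0 : 0 < θ) (h1 : θ ≤ 1) (hN : 0 < N) :
    HasSum (survival θ N) (expectedTime θ N) := by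
  have hnonneg := survival_nonneg (N := N) h0.le h1
  have halive_nonneg (n : ℕ) : 0 ≤ aliveMean θ N n (expectedTime θ) :=
    aliveMean_nonneg h0.le h1 n fun k _ => expectedTime_nonneg h0 h1 k
  have halive_le (n : ℕ) :
      aliveMean θ N n (expectedTime θ) ≤ expectedTime θ N * survival θ N n := by
    rw [survival, ← smul_eq_mul, ← map_smul]
    exact aliveMean_mono h0.le h1 n fun k hk => by simpa using expectedTime_monotone h0 h1 hk.le
  have hsummable : Summable (survival θ N) :=
    summable_of_sum_range_le (c := expectedTime θ N) hnonneg fun n => by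
      rw [sum_survival h0 hN]
      linarith [halive_le n, expectedTime_nonneg h0 h1 N]
  have hsurvival : Tendsto (fun n => expectedTime θ N * survival θ N n) atTop (𝓝 0) := by
    simpa using hsummable.tendsto_atTop_zero.const_mul (expectedTime θ N)
  rw [hasSum_iff_tendsto_nat_of_nonneg hnonneg]
  simp only [sum_survival h0 hN, mul_sub, mul_one]
  have halive := squeeze_zero halive_nonneg halive_le hsurvival
  simpa using (tendsto_const_nhds.sub hsurvival).add halive

end ExpectedTime

section HitTime

variable {Ω : Type*} [MeasurableSpace Ω] {P : Measure Ω} {θ : ℝ} {N : ℕ} {X : ℕ → Ω → ℤ}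

lemma toENNReal_eq_tsum (a : ℕ∞) : (a : ℝ≥0∞) = ∑' n : ℕ, if (n : ℕ∞) < a then 1 else 0 := by
  induction a using ENat.recTopCoe with
  | top => simp
  | coe m =>
    rw [tsum_eq_sum (s := Finset.range m) fun n hn => if_neg (by simpa using hn),
      Finset.sum_congr rfl fun n hn => if_pos (by simpa using hn)]
    simp

lemma measurable_toENNReal {τ : Ω → ℕ∞} (hτ : ∀ n : ℕ, MeasurableSet {ω | (n : ℕ∞) < τ ω}) :
    Measurable fun ω => (τ ω : ℝ≥0∞) := by
  simp only [toENNReal_eq_tsum]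
  exact Measurable.tsum fun n => Measurable.ite (hτ n) measurable_const measurable_const

lemma measurable_normalized {τ : Ω → ℕ∞} (hτ : ∀ n : ℕ, MeasurableSet {ω | (n : ℕ∞) < τ ω}) :
    Measurable (normalized P τ) :=
  ((measurable_toENNReal hτ).div_const _).ennreal_toReal

lemma normalized_nonneg (P : Measure Ω) (τ : Ω → ℕ∞) (ω : Ω) : 0 ≤ normalized P τ ω :=
  ENNReal.toReal_nonneg

lemma mean_eq_tsum {τ : Ω → ℕ∞} (hτ : ∀ n : ℕ, MeasurableSet {ω | (n : ℕ∞) < τ ω}) :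
    mean P τ = ∑' n : ℕ, P {ω | (n : ℕ∞) < τ ω} := by
  simp only [mean, toENNReal_eq_tsum]
  rw [lintegral_tsum fun n =>
    (Measurable.ite (hτ n) measurable_const measurable_const).aemeasurable]
  refine tsum_congr fun n => ?_
  rw [← lintegral_indicator_one (hτ n)]
  simp only [Set.indicator_apply, Set.mem_ofPred_eq, Pi.one_apply]

lemma lt_hitTime_iff {Ω : Type*} {X : ℕ → Ω → ℤ} {n : ℕ} {ω : Ω} :
    (n : ℕ∞) < hitTime N X ω ↔ ∀ k ≤ n, (X k ω).natAbs ≠ N := by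
  rw [← not_le]
  change ¬ hittingAfter X _ 0 ω ≤ WithTop.some n ↔ _
  rw [hittingAfter_le_iff]
  simp [Int.natAbs_eq_iff, or_comm]

lemma measurableSet_lt_hitTime (hX : ∀ n, Measurable (X n)) (n : ℕ) :
    MeasurableSet {ω | (n : ℕ∞) < hitTime N X ω} := by
  simp only [lt_hitTime_iff]
  measurability

lemma killedLaw_transition_eq_zero (hN : 0 < N) (n : ℕ) {x : ℤ} (hx : N < x.natAbs) :
    killedLaw (transition θ) 0 (well N) n x = 0 := by
  cases n with
  | zero => rw [killedLaw, if_neg (by lia)]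
  | succ n =>
    refine Finset.sum_eq_zero fun y hy => ?_
    rw [mem_well] at hy
    rw [transition_eq_add, if_neg (by lia), if_neg (by lia), add_zero, mul_zero]

namespace IsWalk

lemma measurable (hX : IsWalk P θ N X) (n : ℕ) : Measurable (X n) := by
  obtain ⟨Q, -, -, hX⟩ := hX
  exact hX.measurable n

lemma exists_isMarkovChain (hX : IsWalk P θ N X) : ∃ Q,
    killedLaw Q 0 (well N) = killedLaw (transition θ) 0 (well N) ∧ IsMarkovChain P Q 0 X := by
  obtain ⟨Q, -, hQ, hX⟩ := hX
  exact ⟨Q, killedLaw_congr (fun x hx => hQ x (Finset.mem_Ioo.1 hx).1 (Finset.mem_Ioo.1 hx).2) 0,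
    hX⟩

variable [IsProbabilityMeasure P]

lemma measureReal_forall_mem_well (hX : IsWalk P θ N X) (n : ℕ) :
    P.real {ω | ∀ k ≤ n, X k ω ∈ well N} = survival θ N n := by
  obtain ⟨Q, hQ, hX⟩ := hX.exists_isMarkovChain
  rw [hX.measureReal_forall_mem, survival, aliveMean_apply, hQ]
  simp only [Pi.one_apply, mul_one]

lemma ae_natAbs_le (hX : IsWalk P θ N X) (hN : 0 < N) :
    ∀ᵐ ω ∂P, ∀ n, (∀ k < n, X k ω ∈ well N) → (X n ω).natAbs ≤ N := by
  obtain ⟨Q, hQ, hX⟩ := hX.exists_isMarkovChain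
  have hnull (n : ℕ) (x : ℤ) (hx : N < x.natAbs) :
      ∀ᵐ ω ∂P, ¬ ((∀ k < n, X k ω ∈ well N) ∧ X n ω = x) := by
    have hzero := hX.measureReal_forall_mem_and_eq (well N) n x
    rw [hQ, killedLaw_transition_eq_zero hN n hx, measureReal_eq_zero_iff] at hzero
    exact measure_eq_zero_iff_ae_notMem.1 hzero
  filter_upwards [ae_all_iff.2 fun n => ae_all_iff.2 fun x => ae_all_iff.2 (hnull n x)]
    with ω hω n hin
  by_contra! hfar
  exact hω n _ hfar ⟨hin, rfl⟩

lemma ae_lt_hitTime_iff (hX : IsWalk P θ N X) (hN : 0 < N) :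
    ∀ᵐ ω ∂P, ∀ n : ℕ, (n : ℕ∞) < hitTime N X ω ↔ ∀ k ≤ n, X k ω ∈ well N := by
  filter_upwards [hX.ae_natAbs_le hN] with ω hω n
  rw [lt_hitTime_iff]
  refine ⟨fun hne k hk => ?_, fun hin k hk => (mem_well.1 (hin k hk)).ne⟩
  induction k using Nat.strong_induction_on with
  | _ k ih =>
    exact mem_well.2 ((hω k fun j hj => ih j hj (hj.le.trans hk)).lt_of_ne (hne k hk))

lemma measureReal_lt_hitTime (hX : IsWalk P θ N X) (hN : 0 < N) (n : ℕ) :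
    P.real {ω | (n : ℕ∞) < hitTime N X ω} = survival θ N n := by
  rw [← hX.measureReal_forall_mem_well]
  refine measureReal_congr ?_
  filter_upwards [hX.ae_lt_hitTime_iff hN] with ω hω using propext (hω n)

lemma mean_eq (hX : IsWalk P θ N X) (hN : 0 < N) (h0 : 0 < θ) (h1 : θ ≤ 1) :
    mean P (hitTime N X) = ENNReal.ofReal (expectedTime θ N) := by
  have hsum := hasSum_survival h0 h1 hN
  rw [mean_eq_tsum (measurableSet_lt_hitTime hX.measurable), ← hsum.tsum_eq,
    ENNReal.ofReal_tsum_of_nonneg (survival_nonneg h0.le h1) hsum.summable]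
  exact tsum_congr fun n => by rw [← hX.measureReal_lt_hitTime hN, ofReal_measureReal]

lemma mean_pos_lt_top (hX : IsWalk P θ N X) (hN : 0 < N) (h0 : 0 < θ) (h1 : θ ≤ 1) :
    0 < mean P (hitTime N X) ∧ mean P (hitTime N X) < ∞ := by
  rw [hX.mean_eq hN h0 h1]
  exact ⟨ENNReal.ofReal_pos.2 (zero_lt_one.trans_le (one_le_expectedTime h0 h1 hN)),
    ENNReal.ofReal_lt_top⟩

lemma ae_lt_normalized_iff (hX : IsWalk P θ N X) (hN : 0 < N) (h0 : 0 < θ) (h1 : θ ≤ 1) {t : ℝ}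
    (ht : 0 ≤ t) : ∀ᵐ ω ∂P, t < normalized P (hitTime N X) ω ↔
      (⌊t * expectedTime θ N⌋₊ : ℕ∞) < hitTime N X ω := by
  have hmean : 0 < expectedTime θ N := zero_lt_one.trans_le (one_le_expectedTime h0 h1 hN)
  filter_upwards [ae_lt_top (measurable_toENNReal (measurableSet_lt_hitTime hX.measurable))
    (hX.mean_pos_lt_top hN h0 h1).2.ne] with ω hω
  obtain ⟨m, hm⟩ := ENat.ne_top_iff_exists.1 (ENat.toENNReal_lt_top.1 hω).ne
  rw [normalized, hX.mean_eq hN h0 h1, ← hm, ENNReal.toReal_div, ENNReal.toReal_ofReal hmean.le,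
    Nat.cast_lt, Nat.floor_lt (by positivity), ← lt_div_iff₀ hmean]
  simp

lemma measureReal_lt_normalized (hX : IsWalk P θ N X) (hN : 0 < N) (h0 : 0 < θ) (h1 : θ ≤ 1)
    {t : ℝ} (ht : 0 ≤ t) :
    P.real {ω | t < normalized P (hitTime N X) ω} = survival θ N ⌊t * expectedTime θ N⌋₊ := by
  rw [← hX.measureReal_lt_hitTime hN]
  refine measureReal_congr ?_
  filter_upwards [hX.ae_lt_normalized_iff hN h0 h1 ht] with ω hω using propext hω

lemma measureReal_normalized_le (hX : IsWalk P θ N X) (hN : 0 < N) (h0 : 0 < θ) (h1 : θ ≤ 1)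
    {t : ℝ} (ht : 0 ≤ t) :
    P.real {ω | normalized P (hitTime N X) ω ≤ t} =
      1 - survival θ N ⌊t * expectedTime θ N⌋₊ := by
  have hmeas := measurable_normalized (P := P)
    (measurableSet_lt_hitTime (N := N) hX.measurable)
  rw [← hX.measureReal_lt_normalized hN h0 h1 ht,
    ← probReal_compl_eq_one_sub (measurableSet_lt measurable_const hmeas)]
  simp only [Set.compl_ofPred, not_lt]

end IsWalk

end HitTime

section StepGen

variable {θ : ℝ}

/-- The generating function `E[a ^ ξ]` of the outward step `ξ` of the single-well walk, which is `1`
with probability `θ` and `-1` with probability `1 - θ`. -/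
noncomputable def stepGen (θ a : ℝ) : ℝ := θ * a + (1 - θ) / a

lemma radialStep_pow_succ {a : ℝ} (ha : a ≠ 0) (k : ℕ) :
    radialStep θ (a ^ ·) (k + 1) = stepGen θ a * a ^ (k + 1) := by
  simp only [radialStep, stepGen]
  field_simp
  ring

lemma stepGen_sub_one {a : ℝ} (ha : a ≠ 0) :
    stepGen θ a - 1 = (a - 1) * (θ * a - (1 - θ)) / a := by
  rw [stepGen]
  field_simp
  ring

lemma stepGen_nonneg (h0 : 0 ≤ θ) (h1 : θ ≤ 1) {a : ℝ} (ha : 0 ≤ a) : 0 ≤ stepGen θ a :=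
  add_nonneg (mul_nonneg h0 ha) (div_nonneg (sub_nonneg.2 h1) ha)

end StepGen

section Metastability

variable {θ : ℝ} {N : ℕ}

lemma ratio_mul_expectedTime_le (h0 : 0 < θ) (k : ℕ) :
    (1 - θ) / θ * expectedTime θ k ≤ expectedTime θ (k + 1) := by
  have hstep : 0 ≤ k * (1 / θ) := by positivity
  rw [expectedTime, expectedTime, Finset.sum_range_succ', Finset.mul_sum]
  simp only [climb, Finset.sum_add_distrib, Finset.sum_const, Finset.card_range, nsmul_eq_mul]
  linarith

lemma ratio_pow_mul_expectedTime_le (h0 : 0 < θ) (h1 : θ ≤ 1) (k m : ℕ) :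
    ((1 - θ) / θ) ^ m * expectedTime θ k ≤ expectedTime θ (k + m) := by
  induction m with
  | zero => simp
  | succ m ih =>
    rw [pow_succ', mul_assoc, ← add_assoc]
    exact (mul_le_mul_of_nonneg_left ih (ratio_nonneg h0 h1)).trans
      (ratio_mul_expectedTime_le h0 _)

lemma abs_sub_one_sub_pow_le {s ρ : ℕ → ℝ} {p ε : ℝ} (hp0 : 0 ≤ p) (hp1 : p ≤ 1) (hρ0 : ρ 0 = 1)
    (hρ : ∀ n, ρ (n + 1) = ρ n - p * s n) (hs : ∀ n, |s n - ρ n| ≤ ε) (n : ℕ) :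
    |ρ n - (1 - p) ^ n| ≤ ε := by
  induction n with
  | zero => simpa [hρ0] using (abs_nonneg _).trans (hs 0)
  | succ n ih =>
    calc |ρ (n + 1) - (1 - p) ^ (n + 1)|
        = |(1 - p) * (ρ n - (1 - p) ^ n) - p * (s n - ρ n)| := by rw [hρ]; congr 1; ring
      _ ≤ |(1 - p) * (ρ n - (1 - p) ^ n)| + |p * (s n - ρ n)| := abs_sub _ _
      _ = (1 - p) * |ρ n - (1 - p) ^ n| + p * |s n - ρ n| := by
        rw [abs_mul, abs_mul, abs_of_nonneg (sub_nonneg.2 hp1), abs_of_nonneg hp0]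
      _ ≤ (1 - p) * ε + p * ε := add_le_add (mul_le_mul_of_nonneg_left ih (sub_nonneg.2 hp1))
        (mul_le_mul_of_nonneg_left (hs n) hp0)
      _ = ε := by ring

lemma stepGen_lt_one {a : ℝ} (h0 : 0 < θ) (ha : 1 < a) (ha' : a < (1 - θ) / θ) :
    stepGen θ a < 1 := by
  rw [lt_div_iff₀ h0] at ha'
  rw [← sub_neg, stepGen_sub_one (by positivity)]
  exact div_neg_of_neg_of_pos (mul_neg_of_pos_of_neg (by linarith) (by linarith)) (by positivity)

lemma aliveMean_pow_le (h0 : 0 < θ) (h1 : θ ≤ 1) (hN : 0 < N) {a : ℝ} (ha : 1 < a)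
    (ha' : a < (1 - θ) / θ) (n : ℕ) :
    aliveMean θ N n (a ^ ·) ≤ 1 + a / (1 - stepGen θ a) := by
  have ha0 : 0 < a := one_pos.trans ha
  have hgen := stepGen_nonneg h0.le h1 ha0.le
  have hdrift (k : ℕ) : radialStep θ (a ^ ·) k ≤ stepGen θ a * a ^ k + a := by
    cases k with
    | zero => simpa [radialStep] using hgen
    | succ k =>
      rw [radialStep_pow_succ ha0.ne']
      exact le_add_of_nonneg_right ha0.le
  simpa using aliveMean_le_add_div (V := (a ^ ·)) h0.le h1 hN hgen (stepGen_lt_one h0 ha ha')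
    ha0.le (by positivity) (fun k _ => hdrift k) (by positivity) n

lemma aliveMean_expectedTime_le (h0 : 0 < θ) (h1 : θ ≤ 1) (hN : 0 < N) {a : ℝ} (ha : 1 < a)
    (ha' : a < (1 - θ) / θ) (n : ℕ) :
    aliveMean θ N n (expectedTime θ) ≤
      (1 + a / (1 - stepGen θ a)) * a⁻¹ ^ N * expectedTime θ N := by
  have hgrowth (k : ℕ) (hk : k < N) :
      expectedTime θ k ≤ (a⁻¹ ^ N * expectedTime θ N) * a ^ k := by
    have hratio : a ^ (N - k) * expectedTime θ k ≤ expectedTime θ N := by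
      conv_rhs => rw [← Nat.add_sub_cancel' hk.le]
      refine le_trans ?_ (ratio_pow_mul_expectedTime_le h0 h1 k (N - k))
      gcongr
      exact expectedTime_nonneg h0 h1 k
    calc expectedTime θ k = a⁻¹ ^ N * (a ^ (N - k) * expectedTime θ k) * a ^ k := by
          rw [inv_pow, ← pow_sub_mul_pow a hk.le]
          field_simp
      _ ≤ _ := by gcongr
  calc aliveMean θ N n (expectedTime θ)
      ≤ aliveMean θ N n ((a⁻¹ ^ N * expectedTime θ N) • (a ^ ·)) :=
        aliveMean_mono h0.le h1 n hgrowth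
    _ = a⁻¹ ^ N * expectedTime θ N * aliveMean θ N n (a ^ ·) := by rw [map_smul, smul_eq_mul]
    _ ≤ a⁻¹ ^ N * expectedTime θ N * (1 + a / (1 - stepGen θ a)) := by
        gcongr
        · exact mul_nonneg (by positivity) (expectedTime_nonneg h0 h1 N)
        · exact aliveMean_pow_le h0 h1 hN ha ha' n
    _ = _ := by ring

lemma abs_survival_sub_pow_le (h0 : 0 < θ) (h1 : θ ≤ 1) (hN : 0 < N) {a : ℝ} (ha : 1 < a)
    (ha' : a < (1 - θ) / θ) (n : ℕ) :
    |survival θ N n - (1 - 1 / expectedTime θ N) ^ n| ≤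
      2 * (1 + a / (1 - stepGen θ a)) * a⁻¹ ^ N := by
  have hmean := one_le_expectedTime h0 h1 hN
  have hmean_pos : 0 < expectedTime θ N := one_pos.trans_le hmean
  -- `ρ n = ∑ k ≥ n, P(k < τ_N) / E[τ_N]` is the tail of the equilibrium law associated with `τ_N`.
  let ρ : ℕ → ℝ := fun n => 1 - 1 / expectedTime θ N * ∑ k ∈ Finset.range n, survival θ N k
  have hdiff (n : ℕ) : survival θ N n - ρ n =
      aliveMean θ N n (expectedTime θ) / expectedTime θ N := by
    simp only [ρ, sum_survival h0 hN]
    field_simp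
    ring
  have hclose (n : ℕ) : |survival θ N n - ρ n| ≤ (1 + a / (1 - stepGen θ a)) * a⁻¹ ^ N := by
    rw [hdiff, abs_of_nonneg (div_nonneg (aliveMean_nonneg h0.le h1 n fun k _ =>
      expectedTime_nonneg h0 h1 k) hmean_pos.le), div_le_iff₀ hmean_pos]
    exact aliveMean_expectedTime_le h0 h1 hN ha ha' n
  have hgeometric := abs_sub_one_sub_pow_le (ρ := ρ) (s := survival θ N) (by positivity)
    ((div_le_one hmean_pos).2 hmean) (by simp [ρ])
    (fun n => by simp only [ρ, Finset.sum_range_succ]; ring) hclose n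
  linarith [abs_sub_le (survival θ N n) (ρ n) ((1 - 1 / expectedTime θ N) ^ n), hclose n]

lemma tendsto_one_sub_inv_pow_floor {t : ℝ} (ht : 0 ≤ t) :
    Tendsto (fun x : ℝ => (1 - 1 / x) ^ ⌊t * x⌋₊) atTop (𝓝 (Real.exp (-t))) := by
  have hlog := (tendsto_nat_floor_mul_div_atTop ht).mul
    (Real.tendsto_mul_log_one_add_div_atTop (-1))
  rw [mul_neg_one] at hlog
  refine ((Real.continuous_exp.tendsto _).comp hlog).congr' ?_
  filter_upwards [eventually_gt_atTop 1] with x hx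
  have hx0 : 0 < x := one_pos.trans hx
  have hexponent : (⌊t * x⌋₊ : ℝ) / x * (x * Real.log (1 + -1 / x)) =
      ⌊t * x⌋₊ * Real.log (1 - 1 / x) := by
    rw [neg_div, ← sub_eq_add_neg]
    field_simp
  rw [Function.comp_apply, hexponent, Real.exp_nat_mul,
    Real.exp_log (sub_pos.2 ((div_lt_one hx0).2 hx))]

lemma tendsto_survival_floor (h0 : 0 < θ) (h : θ < 1 / 2) {t : ℝ} (ht : 0 ≤ t) :
    Tendsto (fun N => survival θ N ⌊t * expectedTime θ N⌋₊) atTop (𝓝 (Real.exp (-t))) := by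
  have h1 : θ ≤ 1 := by linarith
  obtain ⟨a, ha, ha'⟩ : ∃ a, 1 < a ∧ a < (1 - θ) / θ :=
    exists_between ((one_lt_div h0).2 (by linarith))
  have herror : Tendsto (fun N => survival θ N ⌊t * expectedTime θ N⌋₊ -
      (1 - 1 / expectedTime θ N) ^ ⌊t * expectedTime θ N⌋₊) atTop (𝓝 0) := by
    refine squeeze_zero_norm' (a := fun N => 2 * (1 + a / (1 - stepGen θ a)) * a⁻¹ ^ N) ?_ ?_
    · filter_upwards [eventually_gt_atTop 0] with N hN
      exact abs_survival_sub_pow_le h0 h1 hN ha ha' _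
    · simpa using (tendsto_pow_atTop_nhds_zero_of_lt_one (by positivity)
        (inv_lt_one_of_one_lt₀ ha)).const_mul _
  simpa using herror.add
    ((tendsto_one_sub_inv_pow_floor ht).comp (tendsto_expectedTime_atTop h0 h1))

end Metastability

section TailBounds

variable {θ : ℝ} {N : ℕ}

lemma climb_succ_sub (h0 : 0 < θ) (h : 2 * θ - 1 ≠ 0) (k : ℕ) :
    climb θ (k + 1) - 1 / (2 * θ - 1) = (1 - θ) / θ * (climb θ k - 1 / (2 * θ - 1)) := by
  have hfixed : 1 / (2 * θ - 1) * (2 * θ - 1) = 1 := one_div_mul_cancel h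
  generalize 1 / (2 * θ - 1) = u at hfixed ⊢
  rw [climb]
  field_simp
  linear_combination -hfixed

lemma climb_sub_eq (h0 : 0 < θ) (h : 2 * θ - 1 ≠ 0) (k : ℕ) :
    climb θ k - 1 / (2 * θ - 1) = ((1 - θ) / θ) ^ k * (1 - 1 / (2 * θ - 1)) := by
  induction k with
  | zero => simp [climb]
  | succ k ih => rw [climb_succ_sub h0 h, ih, pow_succ', mul_assoc]

lemma ratio_lt_one (h : 1 / 2 < θ) : (1 - θ) / θ < 1 :=
  (div_lt_one (by linarith)).2 (by linarith)

lemma tendsto_expectedTime_div (h : 1 / 2 < θ) (h1 : θ ≤ 1) :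
    Tendsto (fun N : ℕ => expectedTime θ N / N) atTop (𝓝 (1 / (2 * θ - 1))) := by
  have h0 : 0 < θ := by linarith
  have hclimb : Tendsto (climb θ) atTop (𝓝 (1 / (2 * θ - 1))) := by
    have hpow := tendsto_pow_atTop_nhds_zero_of_lt_one (ratio_nonneg h0 h1) (ratio_lt_one h)
    rw [← tendsto_sub_nhds_zero_iff]
    simpa only [climb_sub_eq h0 (by linarith : 2 * θ - 1 ≠ 0), zero_mul] using
      hpow.mul_const (1 - 1 / (2 * θ - 1))
  exact hclimb.cesaro.congr fun N => inv_mul_eq_div _ _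

lemma stepGen_exp_le (h0 : 0 ≤ θ) (h1 : θ ≤ 1) {s : ℝ} (hs : |s| ≤ 1) :
    stepGen θ (Real.exp s) ≤ Real.exp (s * (2 * θ - 1) + s ^ 2) := by
  have hright := (abs_le.1 (Real.abs_exp_sub_one_sub_id_le hs)).2
  have hleft := (abs_le.1 (Real.abs_exp_sub_one_sub_id_le (x := -s) (by rwa [abs_neg]))).2
  rw [stepGen, div_eq_mul_inv, ← Real.exp_neg]
  linarith [mul_le_mul_of_nonneg_left hright h0,
    mul_le_mul_of_nonneg_left hleft (sub_nonneg.2 h1),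
    Real.add_one_le_exp (s * (2 * θ - 1) + s ^ 2)]

lemma pow_mul_survival_le (h0 : 0 ≤ θ) (h1 : θ ≤ 1) (hN : 0 < N) {a : ℝ} (ha0 : 0 < a)
    (ha1 : a ≤ 1) (n : ℕ) : a ^ N * survival θ N n ≤ stepGen θ a ^ n := by
  have hdrift (k : ℕ) : radialStep θ (a ^ ·) k ≤ stepGen θ a * a ^ k := by
    cases k with
    | zero =>
      have hinv : 1 ≤ a⁻¹ := (one_le_inv₀ ha0).2 ha1
      have hback := mul_le_mul_of_nonneg_left (ha1.trans hinv) (sub_nonneg.2 h1)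
      simp only [radialStep, stepGen, pow_zero, pow_one, div_eq_mul_inv]
      linarith
    | succ k => exact (radialStep_pow_succ ha0.ne' k).le
  calc a ^ N * survival θ N n = aliveMean θ N n (a ^ N • 1) := by
        rw [map_smul, smul_eq_mul, survival]
    _ ≤ aliveMean θ N n (a ^ ·) := aliveMean_mono h0 h1 n fun k hk => by
        simpa using pow_le_pow_of_le_one ha0.le ha1 hk.le
    _ ≤ stepGen θ a ^ n * a ^ 0 := aliveMean_le_pow_mul h0 h1 hN (stepGen_nonneg h0 h1 ha0.le)
        (by positivity) (fun k _ => hdrift k) n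
    _ = stepGen θ a ^ n := by simp

lemma survival_le_exp (h0 : 0 ≤ θ) (h1 : θ ≤ 1) (hN : 0 < N) {s : ℝ} (hs0 : 0 ≤ s) (hs1 : s ≤ 1)
    (n : ℕ) : survival θ N n ≤ Real.exp (s * N + n * (s ^ 2 - s * (2 * θ - 1))) := by
  have hgen := stepGen_exp_le h0 h1 (s := -s) (by rwa [abs_neg, abs_of_nonneg hs0])
  have hpow := (pow_mul_survival_le h0 h1 hN (Real.exp_pos (-s))
    (Real.exp_le_one_iff.2 (by linarith)) n).trans
    (pow_le_pow_left₀ (stepGen_nonneg h0 h1 (Real.exp_pos _).le) hgen n)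
  rw [← Real.exp_nat_mul, ← Real.exp_nat_mul, ← le_div_iff₀' (Real.exp_pos _),
    ← Real.exp_sub] at hpow
  exact hpow.trans_eq (by congr 1; ring)

lemma radialStep_ratio_pow_succ (h0 : 0 < θ) (k : ℕ) :
    radialStep θ (((1 - θ) / θ) ^ ·) (k + 1) = ((1 - θ) / θ) ^ (k + 1) := by
  have hβ : θ * ((1 - θ) / θ) = 1 - θ := mul_div_cancel₀ _ h0.ne'
  simp only [radialStep]
  linear_combination ((1 - θ) / θ) ^ k * ((1 - θ) / θ - 1) * hβ

lemma radialStep_add_mul (f g : ℕ → ℝ) (c : ℝ) (k : ℕ) :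
    radialStep θ (fun j => f j + c * g j) k = radialStep θ f k + c * radialStep θ g k := by
  cases k <;> simp only [radialStep]
  ring

lemma pow_mul_one_sub_survival_le (h : 1 / 2 < θ) (h1 : θ ≤ 1) (hN : 0 < N) {a : ℝ} (ha : 1 ≤ a)
    (n : ℕ) :
    a ^ N * (1 - survival θ N n) ≤ stepGen θ a ^ n * (1 + a / (1 - (1 - θ) / θ)) := by
  have h0 : 0 < θ := by linarith
  have ha0 : 0 < a := one_pos.trans_le ha
  have hβ0 := ratio_nonneg h0 h1
  have hβ1 := ratio_lt_one h
  have hβ : radialStep θ (((1 - θ) / θ) ^ ·) 0 = (1 - θ) / θ := pow_one _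
  have hβ_succ := radialStep_ratio_pow_succ h0
  set β := (1 - θ) / θ
  have hc : a / (1 - β) * (1 - β) = a := div_mul_cancel₀ a (sub_pos.2 hβ1).ne'
  have hc0 : 0 ≤ a / (1 - β) := div_nonneg ha0.le (sub_nonneg.2 hβ1.le)
  generalize a / (1 - β) = c at hc hc0 ⊢
  have hgen : 1 ≤ stepGen θ a := by
    rw [← sub_nonneg, stepGen_sub_one ha0.ne']
    exact div_nonneg (mul_nonneg (by linarith) (by nlinarith)) ha0.le
  -- `a ^ k` alone drifts too much at `0`; `c * β ^ k`, harmonic elsewhere, compensates this.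
  have hdrift (k : ℕ) :
      radialStep θ (fun j => a ^ j + c * β ^ j) k ≤ stepGen θ a * (a ^ k + c * β ^ k) := by
    rw [radialStep_add_mul (a ^ ·) (β ^ ·)]
    cases k with
    | zero =>
      rw [hβ, pow_zero, pow_zero, mul_one]
      calc a ^ 1 + c * β = c := by linear_combination -hc
        _ ≤ 1 + c := by linarith
        _ ≤ stepGen θ a * (1 + c) := le_mul_of_one_le_left (by positivity) hgen
    | succ k =>
      rw [radialStep_pow_succ ha0.ne', hβ_succ, mul_add]
      exact add_le_add le_rfl (le_mul_of_one_le_left (mul_nonneg hc0 (pow_nonneg hβ0 _)) hgen)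
  have hV (k : ℕ) : 0 ≤ a ^ k + c * β ^ k := by positivity
  calc a ^ N * (1 - survival θ N n) ≤ (a ^ N + c * β ^ N) * (1 - survival θ N n) :=
        mul_le_mul_of_nonneg_right (le_add_of_nonneg_right (by positivity))
          (sub_nonneg.2 (survival_le_one h0.le h1 hN n))
    _ ≤ stepGen θ a ^ n * (a ^ 0 + c * β ^ 0) :=
        (le_add_of_nonneg_left (aliveMean_nonneg h0.le h1 n fun k _ => hV k)).trans
          (aliveMean_add_mul_one_sub_survival_le h0.le h1 hN hgen (hV N) (fun k _ => hdrift k) n)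
    _ = stepGen θ a ^ n * (1 + c) := by simp

lemma one_sub_survival_le_exp (h : 1 / 2 < θ) (h1 : θ ≤ 1) (hN : 0 < N) {s : ℝ} (hs0 : 0 ≤ s)
    (hs1 : s ≤ 1) (n : ℕ) :
    1 - survival θ N n ≤ (1 + Real.exp s / (1 - (1 - θ) / θ)) *
      Real.exp (n * (s * (2 * θ - 1) + s ^ 2) - s * N) := by
  have h0 : 0 ≤ θ := by linarith
  have hβ := ratio_lt_one h
  have hgen := stepGen_exp_le h0 h1 (by rwa [abs_of_nonneg hs0])
  have hC : 0 ≤ 1 + Real.exp s / (1 - (1 - θ) / θ) :=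
    add_nonneg one_pos.le (div_nonneg (Real.exp_pos s).le (sub_nonneg.2 hβ.le))
  have hpow := (pow_mul_one_sub_survival_le h h1 hN (Real.one_le_exp hs0) n).trans
    (mul_le_mul_of_nonneg_right
      (pow_le_pow_left₀ (stepGen_nonneg h0 h1 (Real.exp_pos _).le) hgen n) hC)
  rw [← Real.exp_nat_mul, ← Real.exp_nat_mul, ← le_div_iff₀' (Real.exp_pos _)] at hpow
  rw [Real.exp_sub, mul_comm s (N : ℝ)]
  exact hpow.trans_eq (by ring)

lemma summable_exp_natCast_mul {x : ℕ → ℝ} {l : ℝ} (hl : l < 0) (hx : Tendsto x atTop (𝓝 l)) :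
    Summable fun N : ℕ => Real.exp (N * x N) := by
  obtain ⟨r, hlr, hr⟩ := exists_between hl
  refine Summable.of_norm_bounded_eventually_nat (Real.summable_exp_nat_mul_iff.2 hr) ?_
  filter_upwards [hx.eventually_le_const hlr] with N hN
  rw [Real.norm_of_nonneg (Real.exp_pos _).le]
  gcongr

lemma tendsto_floor_expectedTime_div (h : 1 / 2 < θ) (h1 : θ ≤ 1) {t : ℝ} (ht : 0 ≤ t) :
    Tendsto (fun N : ℕ => (⌊t * expectedTime θ N⌋₊ : ℝ) / N) atTop (𝓝 (t / (2 * θ - 1))) := by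
  have h0 : 0 < θ := by linarith
  have hmul := ((tendsto_nat_floor_mul_div_atTop ht).comp (tendsto_expectedTime_atTop h0 h1)).mul
    (tendsto_expectedTime_div h h1)
  rw [mul_one_div] at hmul
  refine hmul.congr' ?_
  filter_upwards [eventually_gt_atTop 0] with N hN
  exact div_mul_div_cancel₀ (one_pos.trans_le (one_le_expectedTime h0 h1 hN)).ne'

lemma exists_mul_lt (c : ℝ) {δ : ℝ} (hδ : 0 < δ) : ∃ s, 0 < s ∧ s ≤ 1 ∧ c * s < δ := by
  have hsmall : ∀ᶠ s in 𝓝[>] (0 : ℝ), c * s < δ :=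
    ((continuous_const_mul c).tendsto' 0 0 (mul_zero c)).mono_left nhdsWithin_le_nhds
      |>.eventually_lt_const hδ
  obtain ⟨s, hs, hs0, hs1⟩ := (hsmall.and (Ioc_mem_nhdsGT one_pos)).exists
  exact ⟨s, hs0, hs1, hs⟩

lemma summable_survival_floor (h : 1 / 2 < θ) (h1 : θ ≤ 1) {t : ℝ} (ht : 1 < t) :
    Summable fun N => survival θ N ⌊t * expectedTime θ N⌋₊ := by
  have h0 : 0 ≤ θ := by linarith
  have hμ : 0 < 2 * θ - 1 := by linarith
  obtain ⟨s, hs0, hs1, hs⟩ := exists_mul_lt (t / (2 * θ - 1)) (sub_pos.2 ht)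
  have hrate : Tendsto (fun N : ℕ => s + (⌊t * expectedTime θ N⌋₊ : ℝ) / N *
      (s ^ 2 - s * (2 * θ - 1))) atTop (𝓝 (s * (t / (2 * θ - 1) * s - (t - 1)))) := by
    convert ((tendsto_floor_expectedTime_div h h1 (one_pos.trans ht).le).mul_const
      (s ^ 2 - s * (2 * θ - 1))).const_add s using 2
    field_simp
    ring
  refine Summable.of_norm_bounded_eventually_nat
    (summable_exp_natCast_mul (mul_neg_of_pos_of_neg hs0 (sub_neg.2 hs)) hrate) ?_
  filter_upwards [eventually_gt_atTop 0] with N hN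
  rw [Real.norm_of_nonneg (survival_nonneg h0 h1 _)]
  convert survival_le_exp h0 h1 hN hs0.le hs1 _ using 2
  field_simp

lemma summable_one_sub_survival_floor (h : 1 / 2 < θ) (h1 : θ ≤ 1) {t : ℝ} (ht0 : 0 ≤ t)
    (ht1 : t < 1) : Summable fun N => 1 - survival θ N ⌊t * expectedTime θ N⌋₊ := by
  have hμ : 0 < 2 * θ - 1 := by linarith
  obtain ⟨s, hs0, hs1, hs⟩ := exists_mul_lt (t / (2 * θ - 1)) (sub_pos.2 ht1)
  have hrate : Tendsto (fun N : ℕ => (⌊t * expectedTime θ N⌋₊ : ℝ) / N *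
      (s * (2 * θ - 1) + s ^ 2) - s) atTop (𝓝 (s * (t / (2 * θ - 1) * s - (1 - t)))) := by
    convert ((tendsto_floor_expectedTime_div h h1 ht0).mul_const
      (s * (2 * θ - 1) + s ^ 2)).sub_const s using 2
    field_simp
    ring
  refine Summable.of_norm_bounded_eventually_nat
    ((summable_exp_natCast_mul (mul_neg_of_pos_of_neg hs0 (sub_neg.2 hs)) hrate).mul_left
      (1 + Real.exp s / (1 - (1 - θ) / θ))) ?_
  filter_upwards [eventually_gt_atTop 0] with N hN
  rw [Real.norm_of_nonneg (sub_nonneg.2 (survival_le_one (by linarith) h1 hN _))]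
  convert one_sub_survival_le_exp h h1 hN hs0.le hs1 _ using 3
  field_simp

end TailBounds

section LimitTheorems

lemma ae_tendsto_of_tsum_tail_ne_top {ι Ω : Type*} [Countable ι] [MeasurableSpace Ω] {P : Measure Ω}
    {Y : ι → Ω → ℝ} {c : ℝ} (hupper : ∀ t, c < t → ∑' i, P {ω | t < Y i ω} ≠ ∞)
    (hlower : ∀ t, t < c → ∑' i, P {ω | Y i ω ≤ t} ≠ ∞) :
    ∀ᵐ ω ∂P, Tendsto (Y · ω) cofinite (𝓝 c) := by
  have hupper_ae : ∀ᵐ ω ∂P, ∀ q : ℚ, c < q → ∀ᶠ i in cofinite, Y i ω ≤ q := by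
    refine ae_all_iff.2 fun q => ?_
    by_cases hq : c < q
    · filter_upwards [ae_finite_setOfPred_mem (hupper q hq)] with ω hω _
      simpa [eventually_cofinite] using hω
    · simp [hq]
  have hlower_ae : ∀ᵐ ω ∂P, ∀ q : ℚ, (q : ℝ) < c → ∀ᶠ i in cofinite, q < Y i ω := by
    refine ae_all_iff.2 fun q => ?_
    by_cases hq : (q : ℝ) < c
    · filter_upwards [ae_finite_setOfPred_mem (hlower q hq)] with ω hω _
      simpa [eventually_cofinite] using hω
    · simp [hq]
  filter_upwards [hupper_ae, hlower_ae] with ω hω hω'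
  refine tendsto_order.2 ⟨fun b hb => ?_, fun b hb => ?_⟩
  · obtain ⟨q, hbq, hqc⟩ := exists_rat_btwn hb
    exact (hω' q hqc).mono fun i hi => hbq.trans hi
  · obtain ⟨q, hcq, hqb⟩ := exists_rat_btwn hb
    exact (hω q hcq).mono fun i hi => hi.trans_lt hqb

lemma tendsto_measureReal_mem_of_ae_tendsto {ι Ω : Type*} {l : Filter ι} [l.IsCountablyGenerated]
    [MeasurableSpace Ω] {P : Measure Ω} [IsProbabilityMeasure P] {Y : ι → Ω → ℝ} {c : ℝ}
    {s : Set ℝ} (hY : ∀ i, Measurable (Y i)) (hlim : ∀ᵐ ω ∂P, Tendsto (Y · ω) l (𝓝 c))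
    (hs : MeasurableSet s) (hc : s ∈ 𝓝 c) :
    Tendsto (fun i => P.real {ω | Y i ω ∈ s}) l (𝓝 1) := by
  have hmeasure : Tendsto (fun i => P (Y i ⁻¹' s)) l (𝓝 (P Set.univ)) := by
    refine tendsto_measure_of_ae_tendsto_indicator_of_isFiniteMeasure l MeasurableSet.univ
      (fun i => hY i hs) ?_
    filter_upwards [hlim] with ω hω
    filter_upwards [hω.eventually_mem hc] with i hi using iff_of_true hi trivial
  rw [measure_univ] at hmeasure
  exact (ENNReal.tendsto_toReal ENNReal.one_ne_top).comp hmeasure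

lemma measureReal_Ioc_eq_sub (μ : Measure ℝ) [IsFiniteMeasure μ] {a b : ℝ} (hab : a ≤ b) :
    μ.real (Set.Ioc a b) = μ.real (Set.Iic b) - μ.real (Set.Iic a) := by
  rw [← Set.Iic_sdiff_Iic, measureReal_sdiff (Set.Iic_subset_Iic.2 hab) measurableSet_Iic]

lemma tendsto_probabilityMeasure_of_tendsto_Iic {ι : Type*} {l : Filter ι}
    [l.IsCountablyGenerated] {μ : ι → ProbabilityMeasure ℝ} {ν : ProbabilityMeasure ℝ}
    (h : ∀ t, Tendsto (fun i => (μ i : Measure ℝ).real (Set.Iic t)) l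
      (𝓝 ((ν : Measure ℝ).real (Set.Iic t)))) : Tendsto μ l (𝓝 ν) := by
  refine (isPiSystem_Ioc_mem Set.univ Set.univ).tendsto_probabilityMeasure_of_tendsto_of_mem
    ?_ ?_ ?_
  · rintro s ⟨a, -, b, -, -, rfl⟩
    exact measurableSet_Ioc
  · intro u hu x hx
    obtain ⟨a, b, ⟨hax, hxb⟩, hsub⟩ := mem_nhds_iff_exists_Ioo_subset.1 (hu.mem_nhds hx)
    obtain ⟨c, hxc, hcb⟩ := exists_between hxb
    exact ⟨Set.Ioc a c, ⟨a, trivial, c, trivial, hax.trans hxc, rfl⟩, Ioc_mem_nhds hax hxc,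
      (Set.Ioc_subset_Ioo_right hcb).trans hsub⟩
  · rintro s ⟨a, -, b, -, hab, rfl⟩
    rw [← NNReal.tendsto_coe]
    change Tendsto (fun i => (μ i : Measure ℝ).real (Set.Ioc a b)) l
      (𝓝 ((ν : Measure ℝ).real (Set.Ioc a b)))
    simp only [measureReal_Ioc_eq_sub _ hab.le]
    exact (h b).sub (h a)

lemma tendstoInDistribution_id_of_tendsto_tail {ι : Type*} {l : Filter ι} [l.IsCountablyGenerated]
    {Ω : ι → Type*} [∀ i, MeasurableSpace (Ω i)] {P : ∀ i, Measure (Ω i)}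
    [∀ i, IsProbabilityMeasure (P i)] {Y : ∀ i, Ω i → ℝ} {ν : Measure ℝ} [IsProbabilityMeasure ν]
    (hY : ∀ i, Measurable (Y i))
    (h : ∀ t, Tendsto (fun i => (P i).real {ω | t < Y i ω}) l (𝓝 (ν.real (Set.Ioi t)))) :
    TendstoInDistribution Y l (id : ℝ → ℝ) P ν := by
  refine ⟨fun i => (hY i).aemeasurable, aemeasurable_id,
    tendsto_probabilityMeasure_of_tendsto_Iic fun t => ?_⟩
  simp only [ProbabilityMeasure.coe_mk, Measure.map_id]
  simp only [← Set.compl_Ioi, map_measureReal_apply (hY _) measurableSet_Ioi.compl]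
  rw [probReal_compl_eq_one_sub measurableSet_Ioi]
  simp only [Set.preimage_compl, probReal_compl_eq_one_sub (hY _ measurableSet_Ioi)]
  exact (h t).const_sub 1

lemma measureReal_expMeasure_Ioi {r t : ℝ} (hr : 0 < r) (ht : 0 ≤ t) :
    (expMeasure r).real (Set.Ioi t) = Real.exp (-(r * t)) := by
  have := isProbabilityMeasure_expMeasure hr
  rw [← Set.compl_Iic, probReal_compl_eq_one_sub measurableSet_Iic, ← cdf_eq_real,
    cdf_expMeasure_eq hr, if_pos ht, sub_sub_cancel]

lemma measureReal_expMeasure_Ioi_of_neg {r t : ℝ} (hr : 0 < r) (ht : t < 0) :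
    (expMeasure r).real (Set.Ioi t) = 1 := by
  have := isProbabilityMeasure_expMeasure hr
  rw [← Set.compl_Iic, probReal_compl_eq_one_sub measurableSet_Iic, ← cdf_eq_real,
    cdf_expMeasure_eq hr, if_neg ht.not_ge, sub_zero]

lemma Metastable.tendstoInDistribution {Ω : ℕ+ → Type*} [∀ N, MeasurableSpace (Ω N)]
    {P : ∀ N, Measure (Ω N)} [∀ N, IsProbabilityMeasure (P N)] {τ : ∀ N, Ω N → ℕ∞}
    (h : Metastable P τ) (hτ : ∀ N (n : ℕ), MeasurableSet {ω | (n : ℕ∞) < τ N ω}) :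
    TendstoInDistribution (fun N => normalized (P N) (τ N)) atTop (id : ℝ → ℝ) P
      (expMeasure 1) := by
  refine tendstoInDistribution_id_of_tendsto_tail (fun N => measurable_normalized (hτ N))
    fun t => ?_
  obtain ht | ht := le_or_gt 0 t
  · simpa only [measureReal_expMeasure_Ioi one_pos ht, one_mul] using h t ht
  · have huniv (N : ℕ+) : {ω | t < normalized (P N) (τ N) ω} = Set.univ :=
      Set.eq_univ_of_forall fun ω => ht.trans_le (normalized_nonneg (P N) (τ N) ω)
    simp only [huniv, probReal_univ, measureReal_expMeasure_Ioi_of_neg one_pos ht,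
      tendsto_const_nhds]

lemma CutOff.of_ae_tendsto {Ω : Type*} [MeasurableSpace Ω] {P : Measure Ω} [IsProbabilityMeasure P]
    {τ : ℕ+ → Ω → ℕ∞} (hτ : ∀ N (n : ℕ), MeasurableSet {ω | (n : ℕ∞) < τ N ω}) {c : ℝ} (hc : 0 < c)
    (hlim : ∀ᵐ ω ∂P, Tendsto (fun N => normalized P (τ N) ω) atTop (𝓝 c)) :
    CutOff (fun _ => P) τ := by
  have hmem := tendsto_measureReal_mem_of_ae_tendsto (fun N => measurable_normalized (hτ N)) hlim
    measurableSet_Ioo (Ioo_mem_nhds (half_lt_self hc) (lt_two_mul_self hc))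
  simp only [Set.mem_Ioo] at hmem
  exact ⟨c / 2, 2 * c, half_pos hc, mul_pos two_pos hc, hmem⟩

end LimitTheorems

section HitTimeLimits

lemma metastable_hitTime {Ω : ℕ+ → Type*} [∀ N, MeasurableSpace (Ω N)] {P : ∀ N, Measure (Ω N)}
    [∀ N, IsProbabilityMeasure (P N)] {X : ∀ N, ℕ → Ω N → ℤ} {θ : ℝ}
    (hX : ∀ N : ℕ+, IsWalk (P N) θ N (X N)) (h0 : 0 < θ) (h : θ < 1 / 2) :
    Metastable P fun N : ℕ+ => hitTime N (X N) := by
  intro t ht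
  refine ((tendsto_survival_floor h0 h ht).comp tendsto_PNat_val_atTop_atTop).congr fun N => ?_
  exact ((hX N).measureReal_lt_normalized N.pos h0 (by linarith) ht).symm

lemma ae_tendsto_normalized {Ω : Type*} [MeasurableSpace Ω] {P : Measure Ω}
    [IsProbabilityMeasure P] {θ : ℝ} {X : ℕ+ → ℕ → Ω → ℤ} (hX : ∀ N : ℕ+, IsWalk P θ N (X N))
    (h : 1 / 2 < θ) (h1 : θ ≤ 1) :
    ∀ᵐ ω ∂P, Tendsto (fun N : ℕ+ => normalized P (hitTime N (X N)) ω) atTop (𝓝 1) := by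
  have h0 : 0 < θ := by linarith
  have hBorelCantelli := ae_tendsto_of_tsum_tail_ne_top (P := P)
    (Y := fun N : ℕ+ => normalized P (hitTime N (X N))) (c := 1) (fun t ht => ?_) fun t ht => ?_
  · filter_upwards [hBorelCantelli] with ω hω using hω.mono_left atTop_le_cofinite
  · have hsum := (summable_survival_floor h h1 ht).comp_injective PNat.coe_injective
    convert hsum.tsum_ofReal_ne_top with N
    rw [Function.comp_apply,
      ← (hX N).measureReal_lt_normalized N.pos h0 h1 (one_pos.trans ht).le, ofReal_measureReal]
  · obtain ht0 | ht0 := le_or_gt 0 t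
    · have hsum := (summable_one_sub_survival_floor h h1 ht0 ht).comp_injective PNat.coe_injective
      convert hsum.tsum_ofReal_ne_top with N
      rw [Function.comp_apply, ← (hX N).measureReal_normalized_le N.pos h0 h1 ht0,
        ofReal_measureReal]
    · have hempty (N : ℕ+) : {ω | normalized P (hitTime N (X N)) ω ≤ t} = ∅ :=
        Set.eq_empty_of_forall_notMem fun ω hω =>
          (hω.trans_lt ht0).not_ge (normalized_nonneg P _ ω)
      simp [hempty]

end HitTimeLimits

end SingleWell

theorem mainTheorem5 :
    (∀ θ : ℝ, 0 < θ → θ < 1 / 2 →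
      ∀ (Ω : ℕ+ → Type*) [∀ N, MeasurableSpace (Ω N)] (P : ∀ N, Measure (Ω N))
        [∀ N, IsProbabilityMeasure (P N)] (X : ∀ N, ℕ → Ω N → ℤ),
        (∀ N : ℕ+, SingleWell.IsWalk (P N) θ N (X N)) →
        (∀ N : ℕ+, 0 < SingleWell.mean (P N) (SingleWell.hitTime N (X N)) ∧
          SingleWell.mean (P N) (SingleWell.hitTime N (X N)) < ∞) ∧
        TendstoInDistribution
          (fun N : ℕ+ => SingleWell.normalized (P N) (SingleWell.hitTime N (X N)))
          atTop (id : ℝ → ℝ) P (expMeasure 1) ∧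
        SingleWell.Metastable P (fun N : ℕ+ => SingleWell.hitTime N (X N))) ∧
    (∀ θ : ℝ, 1 / 2 < θ → θ ≤ 1 →
      ∀ (Ω : Type*) [MeasurableSpace Ω] (P : Measure Ω) [IsProbabilityMeasure P]
        (X : ℕ+ → ℕ → Ω → ℤ),
        (∀ N : ℕ+, SingleWell.IsWalk P θ N (X N)) →
        (∀ N : ℕ+, 0 < SingleWell.mean P (SingleWell.hitTime N (X N)) ∧
          SingleWell.mean P (SingleWell.hitTime N (X N)) < ∞) ∧
        (∀ᵐ ω ∂P, Tendsto
          (fun N : ℕ+ => SingleWell.normalized P (SingleWell.hitTime N (X N)) ω)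
          atTop (𝓝 1)) ∧
        SingleWell.CutOff (fun _ => P) (fun N : ℕ+ => SingleWell.hitTime N (X N))) := by
  refine ⟨fun θ h0 h Ω _ P _ X hX => ?_, fun θ h h1 Ω _ P _ X hX => ?_⟩
  · have hmetastable := SingleWell.metastable_hitTime hX h0 h
    exact ⟨fun N => (hX N).mean_pos_lt_top N.pos h0 (by linarith),
      hmetastable.tendstoInDistribution fun N =>
        SingleWell.measurableSet_lt_hitTime (hX N).measurable,
      hmetastable⟩
  · have hlim := SingleWell.ae_tendsto_normalized hX h h1
    exact ⟨fun N => (hX N).mean_pos_lt_top N.pos (by linarith) h1, hlim,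
      .of_ae_tendsto (fun N => SingleWell.measurableSet_lt_hitTime (hX N).measurable) one_pos
        hlim⟩
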